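/- Let $\mathcal{A}$ be an abelian von Neumann algebra acting on a nonzero complex Hilbert space, let $n\geq 1$ be an integer, and let $\mathbb{M}_n(\mathcal{A})$ be the $*$-algebra of $n\times n$ matrices over $\mathcal{A}$, with $(T^*)_{jk}=(T_{kj})^*$. (Identified with $I_n\mathcal{A}$, the algebra $\mathcal{A}$ is the center of $\mathbb{M}_n(\mathcal{A})$.) Let $\mathcal{P}$ be the lattice of projections $P=P^*=P^2$ in $\mathbb{M}_n(\mathcal{A})$, ordered by $P\leq Q$ iff $PQ=P$. A \emph{quasipoint} of $\mathcal{P}$ is a subset $\mathfrak{B}\subseteq\mathcal{P}$ such that (i) $0\notin\mathfrak{B}$, (ii) for all $P,Q\in\mathfrak{B}$ there is $S\in\mathfrak{B}$ with $S\leq P\wedge Q$, and (iii) $\mathfrak{B}$ is maximal (with respect to inclusion) among the subsets satisfying (i) and (ii). A projection $E\in\mathcal{P}$ is \emph{abelian} if the algebra $E\,\mathbb{M}_n(\mathcal{A})\,E$ is commutative, and a quasipoint is \emph{abelian} if it contains an abelian projection. Theorem. Every quasipoint of the projection lattice of $\mathbb{M}_n(\mathcal{A})$ is abelian. -/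

import Mathlib

/-- A filter base in a partially ordered set with least element: a set that does not contain `0`
and in which any two elements have a lower bound belonging to the set. When meets exist,
`c ≤ a ∧ c ≤ b` says exactly `c ≤ a ⊓ b`; see `isFilterBase_iff_inf`. -/
def IsFilterBase {L : Type*} [PartialOrder L] [OrderBot L] (B : Set L) : Prop :=
  ⊥ ∉ B ∧ ∀ a ∈ B, ∀ b ∈ B, ∃ c ∈ B, c ≤ a ∧ c ≤ b

/-- A quasipoint: a maximal filter base. -/
def IsQuasipoint {L : Type*} [PartialOrder L] [OrderBot L] (B : Set L) : Prop :=
  Maximal IsFilterBase B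

theorem isFilterBase_iff_inf {L : Type*} [Lattice L] [OrderBot L] (B : Set L) :
    IsFilterBase B ↔ ⊥ ∉ B ∧ ∀ a ∈ B, ∀ b ∈ B, ∃ c ∈ B, c ≤ a ⊓ b := by
  simp only [IsFilterBase, le_inf_iff]

/-- The (self-adjoint) projections of a star ring. -/
def ProjectionLattice (R : Type*) [Ring R] [StarRing R] : Type _ :=
  {p : R // IsStarProjection p}

/-- The usual order of projections: `p ≤ q` iff `p q = p` (for operators: iff the range of `p` is
contained in the range of `q`). -/
instance ProjectionLattice.instPartialOrder (R : Type*) [Ring R] [StarRing R] :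
    PartialOrder (ProjectionLattice R) where
  le p q := p.1 * q.1 = p.1
  le_refl p := p.2.isIdempotentElem
  le_trans p q r (hpq : p.1 * q.1 = p.1) (hqr : q.1 * r.1 = q.1) := by
    rw [← hpq, mul_assoc, hqr]
  le_antisymm p q (hpq : p.1 * q.1 = p.1) (hqp : q.1 * p.1 = q.1) := by
    apply Subtype.ext
    have h := congrArg star hpq
    rw [star_mul, p.2.isSelfAdjoint.star_eq, q.2.isSelfAdjoint.star_eq, hqp] at h
    exact h.symm

/-- The least projection is `0`. -/
instance ProjectionLattice.instOrderBot (R : Type*) [Ring R] [StarRing R] :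
    OrderBot (ProjectionLattice R) where
  bot := ⟨0, IsStarProjection.zero R⟩
  bot_le p := zero_mul p.1

/-- A projection `e` of `R` is abelian if the corner `e R e` is commutative. -/
def ProjectionLattice.IsAbelian {R : Type*} [Ring R] [StarRing R] (e : ProjectionLattice R) :
    Prop :=
  ∀ x y : R, Commute (e.1 * x * e.1) (e.1 * y * e.1)

/-- A quasipoint is abelian if it contains an abelian projection. -/
def IsAbelianQuasipoint {R : Type*} [Ring R] [StarRing R] (B : Set (ProjectionLattice R)) : Prop :=
  IsQuasipoint B ∧ ∃ e ∈ B, e.IsAbelian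

/-- A von Neumann algebra acting on `H` is abelian if its elements commute. -/
def VonNeumannAlgebra.IsAbelian {H : Type*} [NormedAddCommGroup H] [InnerProductSpace ℂ H]
    [CompleteSpace H] (A : VonNeumannAlgebra H) : Prop :=
  ∀ x ∈ A, ∀ y ∈ A, Commute x y

/-- The star algebra `M_n(A)` of `n × n` matrices with entries in the von Neumann algebra `A`,
with matrix multiplication and the conjugate transpose as involution. -/
abbrev VonNeumannAlgebra.MatrixAlgebra {H : Type*} [NormedAddCommGroup H] [InnerProductSpace ℂ H]
    [CompleteSpace H] (n : ℕ) (A : VonNeumannAlgebra H) : Type _ :=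
  Matrix (Fin n) (Fin n) A.toStarSubalgebra

open WeakDual

universe u

/-! By Gelfand duality `A` is `C(X, ℂ)` with `X` a Stone space, so a projection of the matrix
algebra is a continuous field of projections on `ℂⁿ`, with locally constant rank. For a quasipoint
`B`, compactness yields a point `x` where no member of `B` vanishes. Take `Q ∈ B` of minimal rank at
`x`. A member of `B` below `Q` has the same rank at `x`, hence near `x`, so it equals `Q` near `x`.
Thus every member of `B` dominates `Q` near `x`. Cut a rank-one field `E ≤ Q` out of `Q` on a clopen
neighbourhood of `x` (`exists_isAbelian`). Its restrictions to clopen neighbourhoods of `x` form a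
filter base with an element below each member of `B`, so maximality (`subset_of_coinitial`) puts `E`
in `B`. -/

theorem IsQuasipoint.subset_of_coinitial {L : Type*} [PartialOrder L] [OrderBot L] {B S : Set L}
    (hB : IsQuasipoint B) (hS : IsFilterBase S) (h : ∀ b ∈ B, ∃ s ∈ S, s ≤ b) : S ⊆ B := by
  -- The upward closure of `S` is a filter base containing `B`, so by maximality it lies in `B`.
  have hT : IsFilterBase {a | ∃ s ∈ S, s ≤ a} := by
    refine ⟨fun ⟨s, hs, hs'⟩ => hS.1 (le_bot_iff.1 hs' ▸ hs), ?_⟩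
    rintro a ⟨s, hs, hsa⟩ b ⟨t, ht, htb⟩
    obtain ⟨u, hu, hus, hut⟩ := hS.2 s hs t ht
    exact ⟨u, ⟨u, hu, le_rfl⟩, hus.trans hsa, hut.trans htb⟩
  exact fun s hs => hB.2 hT h ⟨s, hs, le_rfl⟩

theorem IsQuasipoint.nonempty {L : Type*} [PartialOrder L] [OrderBot L] [Nontrivial L] {B : Set L}
    (hB : IsQuasipoint B) : B.Nonempty := by
  by_contra h
  rw [Set.not_nonempty_iff_eq_empty] at h
  obtain ⟨a, ha⟩ := exists_ne (⊥ : L)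
  have hS : IsFilterBase {a} :=
    ⟨fun h => ha h.symm, fun b hb c hc => ⟨a, rfl, ge_of_eq hb, ge_of_eq hc⟩⟩
  have := hB.subset_of_coinitial hS (by simp [h])
  simp [h] at this

theorem IsFilterBase.image_orderIso {L M : Type*} [PartialOrder L] [OrderBot L] [PartialOrder M]
    [OrderBot M] (e : L ≃o M) {B : Set L} (hB : IsFilterBase B) : IsFilterBase (e '' B) := by
  refine ⟨?_, ?_⟩
  · rintro ⟨b, hb, hb'⟩
    exact hB.1 ((map_eq_bot_iff e).1 hb' ▸ hb)
  · rintro _ ⟨a, ha, rfl⟩ _ ⟨b, hb, rfl⟩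
    obtain ⟨c, hc, hca, hcb⟩ := hB.2 a ha b hb
    exact ⟨e c, ⟨c, hc, rfl⟩, e.monotone hca, e.monotone hcb⟩

theorem IsQuasipoint.image_orderIso {L M : Type*} [PartialOrder L] [OrderBot L] [PartialOrder M]
    [OrderBot M] (e : L ≃o M) {B : Set L} (hB : IsQuasipoint B) : IsQuasipoint (e '' B) := by
  refine ⟨hB.1.image_orderIso e, fun C hC hBC c hc => ?_⟩
  have h := hB.2 (hC.image_orderIso e.symm) fun b hb => ⟨e b, hBC ⟨b, hb, rfl⟩, by simp⟩
  exact ⟨e.symm c, h ⟨c, hc, rfl⟩, by simp⟩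

/-- The isomorphism of projection lattices induced by an isomorphism of star rings. -/
def ProjectionLattice.congr {R S : Type*} [Ring R] [StarRing R] [Ring S] [StarRing S]
    (f : R ≃⋆+* S) : ProjectionLattice R ≃o ProjectionLattice S where
  toFun p := ⟨f p.1, p.2.map f⟩
  invFun p := ⟨f.symm p.1, p.2.map f.symm⟩
  left_inv p := Subtype.ext (f.symm_apply_apply p.1)
  right_inv p := Subtype.ext (f.apply_symm_apply p.1)
  map_rel_iff' {p q} := by
    change f p.1 * f q.1 = f p.1 ↔ p.1 * q.1 = p.1
    rw [← map_mul, EmbeddingLike.apply_eq_iff_eq]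

theorem IsAbelianQuasipoint.of_starRingEquiv {R S : Type*} [Ring R] [StarRing R] [Ring S]
    [StarRing S] (f : R ≃⋆+* S)
    (h : ∀ C : Set (ProjectionLattice S), IsQuasipoint C → ∃ e ∈ C, e.IsAbelian)
    {B : Set (ProjectionLattice R)} (hB : IsQuasipoint B) : IsAbelianQuasipoint B := by
  refine ⟨hB, ?_⟩
  obtain ⟨_, ⟨e, he, rfl⟩, hab⟩ := h _ (hB.image_orderIso (ProjectionLattice.congr f))
  refine ⟨e, he, fun x y => EquivLike.injective f ?_⟩
  have h := (hab (f x) (f y)).eq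
  change f e.1 * f x * f e.1 * (f e.1 * f y * f e.1) =
    f e.1 * f y * f e.1 * (f e.1 * f x * f e.1) at h
  simpa only [map_mul] using h

/-- The isomorphism of matrix star rings induced by an isomorphism of star rings. -/
def StarRingEquiv.mapMatrix {m R S : Type*} [Fintype m] [DecidableEq m] [Ring R] [StarRing R]
    [Ring S] [StarRing S] (f : R ≃⋆+* S) : Matrix m m R ≃⋆+* Matrix m m S where
  toRingEquiv := f.toRingEquiv.mapMatrix
  map_star' M := by
    ext i j
    exact map_star f (M j i)

/-! ### Gelfand duality: the spectrum is a Stone space. -/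

/-- Orthogonal elements of an abelian von Neumann algebra are separated by a projection. -/
theorem VonNeumannAlgebra.exists_isStarProjection_mul_eq {H : Type*} [NormedAddCommGroup H]
    [InnerProductSpace ℂ H] [CompleteSpace H] (A : VonNeumannAlgebra H) {b c : H →L[ℂ] H}
    (hc : c ∈ A) (hcb : c * b = 0) :
    ∃ q ∈ A, IsStarProjection q ∧ q * b = b ∧ c * q = 0 := by
  have hK : IsClosed (c.ker : Set H) := c.isClosed_ker
  have : CompleteSpace c.ker := hK.completeSpace_coe
  refine ⟨c.ker.starProjection, ?_, isStarProjection_starProjection, ?_, ?_⟩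
  -- Bicommutant argument: whatever commutes with `c` leaves `ker c` invariant.
  · rw [IsStarProjection.mem_iff isStarProjection_starProjection]
    intro y hy
    rw [Submodule.range_starProjection, Module.End.mem_invtSubmodule_iff_forall_mem_of_mem]
    intro v hv
    have h := congr($(mem_commutant_iff.1 hy c hc) v)
    have hv' : c v = 0 := hv
    change c (y v) = 0
    simpa [hv'] using h
  · ext v
    exact Submodule.starProjection_eq_self_iff.2 (congr($hcb v) : (c * b) v = 0)
  · ext v
    exact Submodule.starProjection_apply_mem c.ker v

theorem VonNeumannAlgebra.isClosed {H : Type*} [NormedAddCommGroup H]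
    [InnerProductSpace ℂ H] [CompleteSpace H] (A : VonNeumannAlgebra H) :
    IsClosed (A.toStarSubalgebra : Set (H →L[ℂ] H)) := by
  rw [coe_toStarSubalgebra, ← A.centralizer_centralizer]
  exact Set.isClosed_centralizer _

/-- The Gelfand spectrum of a commutative C⋆-algebra is totally separated if orthogonal elements
are separated by an idempotent. -/
theorem WeakDual.CharacterSpace.totallySeparatedSpace {A : Type*} [CommCStarAlgebra A]
    (h : ∀ b c : A, c * b = 0 → ∃ q : A, IsIdempotentElem q ∧ q * b = b ∧ c * q = 0) :
    TotallySeparatedSpace (characterSpace ℂ A) := by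
  refine ⟨fun φ _ ψ _ hne => ?_⟩
  obtain ⟨a, ha⟩ : ∃ a, φ a ≠ ψ a := by
    by_contra! h
    exact hne (CharacterSpace.ext h)
  -- Cutting `r` at half its value at `ψ` gives `F`, `G` with product zero, `F ψ ≠ 0` and `G φ ≠ 0`.
  -- The separating idempotent is then 1 at `ψ` and 0 at `φ`.
  let r : C(characterSpace ℂ A, ℝ) := ⟨fun x => ‖gelfandTransform ℂ A a x - φ a‖, by fun_prop⟩
  have hrφ : r φ = 0 := by simp [r]
  have hrψ : 0 < r ψ := by simpa [r, sub_eq_zero] using ha.symm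
  let F : C(characterSpace ℂ A, ℂ) := ⟨fun x => ((max (r x - r ψ / 2) 0 : ℝ) : ℂ), by fun_prop⟩
  let G : C(characterSpace ℂ A, ℂ) := ⟨fun x => ((max (r ψ / 2 - r x) 0 : ℝ) : ℂ), by fun_prop⟩
  have hGF : G * F = 0 := by
    ext x
    rcases le_total (r x) (r ψ / 2) with hx | hx
    · simp [F, G, max_eq_right (sub_nonpos.2 hx)]
    · simp [F, G, max_eq_right (sub_nonpos.2 hx)]
  have hFψ : F ψ ≠ 0 := by
    simp only [F, ContinuousMap.coe_mk, ne_eq, Complex.ofReal_eq_zero]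
    exact (lt_max_of_lt_left (by linarith)).ne'
  have hGφ : G φ ≠ 0 := by
    simp only [G, ContinuousMap.coe_mk, ne_eq, Complex.ofReal_eq_zero]
    exact (lt_max_of_lt_left (by linarith)).ne'
  let Γ := gelfandStarTransform A
  obtain ⟨q, hq, hqb, hcq⟩ := h (Γ.symm F) (Γ.symm G) (by rw [← map_mul, hGF, map_zero])
  have hb : ψ (Γ.symm F) = F ψ := congr($(Γ.apply_symm_apply F) ψ)
  have hc : φ (Γ.symm G) = G φ := congr($(Γ.apply_symm_apply G) φ)
  have hqψ : ψ q = 1 := by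
    have := congrArg ψ hqb
    rw [map_mul, hb] at this
    exact (mul_eq_right₀ hFψ).1 this
  have hqφ : φ q = 0 := by
    have := congrArg φ hcq
    rw [map_mul, hc, map_zero] at this
    exact (mul_eq_zero.1 this).resolve_left hGφ
  have hval (x : characterSpace ℂ A) : x q = 0 ∨ x q = 1 :=
    IsIdempotentElem.iff_eq_zero_or_one.1 (hq.map x)
  have hcont : Continuous fun x : characterSpace ℂ A => x q := (gelfandTransform ℂ A q).continuous
  refine ⟨{x | x q ≠ 1}, {x | x q ≠ 0}, isOpen_ne.preimage hcont, isOpen_ne.preimage hcont,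
    by simp [hqφ], by simp [hqψ], fun x _ => ?_, ?_⟩
  · rcases hval x with hx | hx <;> simp [hx]
  · rw [Set.disjoint_left]
    intro x h1 h0
    exact (hval x).elim h0 h1

/-- An abelian von Neumann algebra is isomorphic to the algebra of continuous functions on a
Stone space. -/
theorem VonNeumannAlgebra.IsAbelian.exists_starAlgEquiv {H : Type u} [NormedAddCommGroup H]
    [InnerProductSpace ℂ H] [CompleteSpace H] [Nontrivial H] {A : VonNeumannAlgebra H}
    (hA : A.IsAbelian) :
    ∃ (X : Type u) (_ : TopologicalSpace X) (_ : CompactSpace X) (_ : T2Space X)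
      (_ : TotallyDisconnectedSpace X) (_ : Nonempty X),
      Nonempty (A.toStarSubalgebra ≃⋆ₐ[ℂ] C(X, ℂ)) := by
  have := A.isClosed
  let _ : CommCStarAlgebra A.toStarSubalgebra :=
    { StarSubalgebra.cstarAlgebra A.toStarSubalgebra with
      mul_comm := fun x y => Subtype.ext (hA x x.2 y y.2) }
  have : TotallySeparatedSpace (characterSpace ℂ A.toStarSubalgebra) := by
    apply CharacterSpace.totallySeparatedSpace
    intro b c hcb
    obtain ⟨q, hqA, hq, hqb, hcq⟩ :=
      A.exists_isStarProjection_mul_eq c.2 (congrArg Subtype.val hcb)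
    exact ⟨⟨q, hqA⟩, Subtype.ext hq.isIdempotentElem, Subtype.ext hqb, Subtype.ext hcq⟩
  exact ⟨characterSpace ℂ A.toStarSubalgebra, inferInstance, inferInstance, inferInstance,
    inferInstance, inferInstance, ⟨gelfandStarTransform A.toStarSubalgebra⟩⟩

/-! ### Projections in complex matrices. -/

namespace Matrix

variable {m : Type*} [Fintype m]

open scoped ComplexOrder in
theorem eq_zero_of_isStarProjection_of_trace_eq_zero {q : Matrix m m ℂ} (hq : IsStarProjection q)
    (h : q.trace = 0) : q = 0 := by
  rw [← trace_conjTranspose_mul_self_eq_zero_iff, ← star_eq_conjTranspose,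
    hq.isSelfAdjoint.star_eq, hq.isIdempotentElem.eq, h]

theorem eq_of_isStarProjection_of_trace_eq {p q : Matrix m m ℂ} (hp : IsStarProjection p)
    (hq : IsStarProjection q) (hpq : p * q = p) (h : p.trace = q.trace) : p = q := by
  have := eq_zero_of_isStarProjection_of_trace_eq_zero (hp.sub_of_mul_eq_left hq hpq)
    (by rw [trace_sub, h, sub_self])
  exact (sub_eq_zero.1 this).symm

variable [DecidableEq m]

theorem exists_nat_trace_eq_of_isStarProjection {q : Matrix m m ℂ} (hq : IsStarProjection q) :
    ∃ k : ℕ, q.trace = k := by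
  have h : IsIdempotentElem (toLin' q) := by
    rw [IsIdempotentElem, Module.End.mul_eq_comp, ← toLin'_mul, hq.isIdempotentElem.eq]
  exact ⟨_, (trace_toLin'_eq q).symm.trans (LinearMap.IsIdempotentElem.isProj_range _ h).trace⟩

/-- Compressing by the matrix unit leaves only the `(i, i)` entry. This gives idempotence below
(with `x = 1`) and later commutativity of the corner. -/
theorem mul_single_mul_mul_mul_single_mul (q x : Matrix m m ℂ) (i : m) :
    q * single i i 1 * q * x * (q * single i i 1 * q) =
      (q * x * q) i i • (q * single i i 1 * q) := by
  have : q * single i i 1 * q * x * (q * single i i 1 * q) =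
      q * (single i i 1 * (q * x * q) * single i i 1) * q := by
    simp only [mul_assoc]
  have hsingle : single i i ((q * x * q) i i) = (q * x * q) i i • single i i (1 : ℂ) := by
    rw [smul_single, smul_eq_mul, mul_one]
  rw [this, single_mul_mul_single, one_mul, mul_one, hsingle, Matrix.mul_smul, Matrix.smul_mul]

/-- This is the projection onto the line spanned by `q eᵢ`, whose squared norm is `q i i`. -/
theorem isStarProjection_inv_smul_mul_single_mul {q : Matrix m m ℂ} (hq : IsStarProjection q)
    {i : m} (hi : q i i ≠ 0) : IsStarProjection ((q i i)⁻¹ • (q * single i i 1 * q)) := by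
  refine ⟨?_, ?_⟩
  · have h := mul_single_mul_mul_mul_single_mul q 1 i
    rw [mul_one, mul_one, hq.isIdempotentElem.eq] at h
    rw [IsIdempotentElem, smul_mul_smul_comm, h, smul_smul, mul_assoc, inv_mul_cancel₀ hi, mul_one]
  · have hstar : star (q i i) = q i i := congr($(hq.isSelfAdjoint.star_eq) i i)
    rw [IsSelfAdjoint, star_smul, star_inv₀, hstar, star_mul, star_mul, hq.isSelfAdjoint.star_eq,
      star_eq_conjTranspose (single i i 1), conjTranspose_single, star_one, mul_assoc]

end Matrix

/-! ### Projections as continuous fields of matrices. -/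

section ContinuousMatrix

open Matrix

variable {n : ℕ} {X : Type*} [TopologicalSpace X]

/-- Evaluation of a matrix of continuous functions at a point. -/
noncomputable def evalMatrix (x : X) :
    Matrix (Fin n) (Fin n) C(X, ℂ) →+* Matrix (Fin n) (Fin n) ℂ :=
  (ContinuousMap.evalAlgHom ℂ ℂ x).toRingHom.mapMatrix

@[simp]
theorem evalMatrix_apply (x : X) (P : Matrix (Fin n) (Fin n) C(X, ℂ)) (i j : Fin n) :
    evalMatrix x P i j = P i j x := rfl

theorem evalMatrix_star (x : X) (P : Matrix (Fin n) (Fin n) C(X, ℂ)) :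
    evalMatrix x (star P) = star (evalMatrix x P) := rfl

theorem evalMatrix_smul (x : X) (f : C(X, ℂ)) (P : Matrix (Fin n) (Fin n) C(X, ℂ)) :
    evalMatrix x (f • P) = f x • evalMatrix x P := rfl

theorem evalMatrix_single (x : X) (i : Fin n) :
    evalMatrix x (single i i 1) = single i i 1 := by
  ext j k
  rw [evalMatrix_apply, single_apply, single_apply]
  split_ifs <;> rfl

theorem evalMatrix_ext {P Q : Matrix (Fin n) (Fin n) C(X, ℂ)}
    (h : ∀ x, evalMatrix x P = evalMatrix x Q) : P = Q := by
  ext i j x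
  exact congr($(h x) i j)

theorem isStarProjection_of_evalMatrix {P : Matrix (Fin n) (Fin n) C(X, ℂ)}
    (h : ∀ x, IsStarProjection (evalMatrix x P)) : IsStarProjection P where
  isIdempotentElem := evalMatrix_ext fun x => by
    rw [map_mul, (h x).isIdempotentElem.eq]
  isSelfAdjoint := evalMatrix_ext fun x => by
    rw [evalMatrix_star, (h x).isSelfAdjoint.star_eq]

namespace ProjectionLattice

/-- The value at a point of a projection in the matrices of continuous functions. -/
noncomputable def fiber (P : ProjectionLattice (Matrix (Fin n) (Fin n) C(X, ℂ))) (x : X) :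
    Matrix (Fin n) (Fin n) ℂ :=
  evalMatrix x P.1

variable {P Q : ProjectionLattice (Matrix (Fin n) (Fin n) C(X, ℂ))}

theorem isStarProjection_fiber (P : ProjectionLattice (Matrix (Fin n) (Fin n) C(X, ℂ))) (x : X) :
    IsStarProjection (P.fiber x) where
  isIdempotentElem := P.2.isIdempotentElem.map _
  isSelfAdjoint := by
    rw [IsSelfAdjoint, fiber, ← evalMatrix_star, P.2.isSelfAdjoint.star_eq]

theorem ext_fiber (h : ∀ x, P.fiber x = Q.fiber x) : P = Q :=
  Subtype.ext (evalMatrix_ext h)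

theorem le_iff_fiber : P ≤ Q ↔ ∀ x, P.fiber x * Q.fiber x = P.fiber x := by
  refine ⟨fun h x => ?_, fun h => evalMatrix_ext fun x => ?_⟩
  · have h' : P.1 * Q.1 = P.1 := h
    rw [fiber, fiber, ← map_mul, h']
  · rw [map_mul]
    exact h x

theorem fiber_bot (x : X) :
    (⊥ : ProjectionLattice (Matrix (Fin n) (Fin n) C(X, ℂ))).fiber x = 0 :=
  map_zero (evalMatrix x)

theorem exists_fiber_ne_zero (h : P ≠ ⊥) : ∃ x, P.fiber x ≠ 0 := by
  by_contra! h'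
  exact h (ext_fiber fun x => by rw [h' x, fiber_bot])

theorem isClopen_setOf_trace_fiber_eq (P : ProjectionLattice (Matrix (Fin n) (Fin n) C(X, ℂ)))
    (k : ℕ) : IsClopen {x | (P.fiber x).trace = k} := by
  have hcont : Continuous fun x => (P.fiber x).trace :=
    continuous_finsetSum _ fun i _ => (P.1 i i).continuous
  refine ⟨isClosed_singleton.preimage hcont, ?_⟩
  -- Traces of projections are natural numbers, so distance less than 1 from `k` means equality.
  convert (Metric.isOpen_ball (x := (k : ℂ)) (ε := 1)).preimage hcont using 1
  ext x
  obtain ⟨l, hl⟩ := exists_nat_trace_eq_of_isStarProjection (P.isStarProjection_fiber x)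
  simp only [Set.mem_ofPred_eq, Set.mem_preimage, hl, Metric.mem_ball, Nat.cast_inj]
  refine ⟨fun h => by simp [h], fun h => ?_⟩
  rw [Complex.dist_eq, ← Int.cast_natCast l, ← Int.cast_natCast k, ← Int.cast_sub,
    Complex.norm_intCast] at h
  have h' : |(l : ℤ) - k| < 1 := by exact_mod_cast h
  exact_mod_cast sub_eq_zero.1 (Int.abs_lt_one_iff.1 h')

theorem isClopen_setOf_fiber_ne_zero (P : ProjectionLattice (Matrix (Fin n) (Fin n) C(X, ℂ))) :
    IsClopen {x | P.fiber x ≠ 0} := by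
  convert (P.isClopen_setOf_trace_fiber_eq 0).compl using 1
  ext x
  refine not_congr ⟨fun h => by simp [h], fun h => ?_⟩
  exact eq_zero_of_isStarProjection_of_trace_eq_zero (P.isStarProjection_fiber x) (by simpa using h)

open Classical in
-- Extension by zero is continuous because `U` is clopen; `f = 1` gives the indicator of `U`.
theorem exists_continuousMap_eq_ite_inv {U : Set X} (hU : IsClopen U) {f : C(X, ℂ)}
    (hf : ∀ x ∈ U, f x ≠ 0) : ∃ g : C(X, ℂ), ∀ x, g x = if x ∈ U then (f x)⁻¹ else 0 := by
  refine ⟨⟨fun x => if x ∈ U then (f x)⁻¹ else 0, ?_⟩, fun x => rfl⟩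
  refine continuous_iff_continuousAt.2 fun x => ?_
  by_cases hx : x ∈ U
  · refine (f.continuous.continuousAt.inv₀ (hf x hx)).congr ?_
    filter_upwards [hU.isOpen.mem_nhds hx] with y hy using (if_pos hy).symm
  · refine (continuousAt_const (y := (0 : ℂ))).congr ?_
    filter_upwards [hU.compl.isOpen.mem_nhds hx] with y hy using (if_neg hy).symm

open Classical in
theorem exists_restrict {U : Set X} (hU : IsClopen U)
    (P : ProjectionLattice (Matrix (Fin n) (Fin n) C(X, ℂ))) :
    ∃ Q : ProjectionLattice (Matrix (Fin n) (Fin n) C(X, ℂ)),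
      ∀ x, Q.fiber x = if x ∈ U then P.fiber x else 0 := by
  obtain ⟨g, hg⟩ := exists_continuousMap_eq_ite_inv hU (f := 1) (fun x _ => one_ne_zero)
  have h (x : X) : evalMatrix x (g • P.1) = if x ∈ U then P.fiber x else 0 := by
    rw [evalMatrix_smul, hg, ContinuousMap.one_apply, inv_one, ite_smul, one_smul, zero_smul, fiber]
  refine ⟨⟨g • P.1, isStarProjection_of_evalMatrix fun x => ?_⟩, h⟩
  rw [h]
  split_ifs
  exacts [P.isStarProjection_fiber x, .zero _]

/-- The product of a projection with the indicator function of a clopen set. -/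
noncomputable def restrict {U : Set X} (hU : IsClopen U)
    (P : ProjectionLattice (Matrix (Fin n) (Fin n) C(X, ℂ))) :
    ProjectionLattice (Matrix (Fin n) (Fin n) C(X, ℂ)) :=
  (exists_restrict hU P).choose

open Classical in
theorem fiber_restrict {U : Set X} (hU : IsClopen U)
    (P : ProjectionLattice (Matrix (Fin n) (Fin n) C(X, ℂ))) (x : X) :
    (restrict hU P).fiber x = if x ∈ U then P.fiber x else 0 :=
  (exists_restrict hU P).choose_spec x

open Classical in
/-- Below a projection with a nonvanishing diagonal entry on a clopen set there is an abelian
projection with full support on that set. -/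
theorem exists_isAbelian {U : Set X} (hU : IsClopen U)
    (Q : ProjectionLattice (Matrix (Fin n) (Fin n) C(X, ℂ))) {i : Fin n}
    (hi : ∀ x ∈ U, Q.fiber x i i ≠ 0) :
    ∃ E : ProjectionLattice (Matrix (Fin n) (Fin n) C(X, ℂ)),
      E.IsAbelian ∧ E ≤ Q ∧ ∀ x, E.fiber x ≠ 0 ↔ x ∈ U := by
  obtain ⟨g, hg⟩ := exists_continuousMap_eq_ite_inv hU hi
  have heval (x : X) : evalMatrix x (g • (Q.1 * single i i 1 * Q.1)) =
      g x • (Q.fiber x * single i i 1 * Q.fiber x) := by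
    rw [evalMatrix_smul, map_mul, map_mul, evalMatrix_single, fiber]
  let E : ProjectionLattice (Matrix (Fin n) (Fin n) C(X, ℂ)) :=
    ⟨g • (Q.1 * single i i 1 * Q.1), isStarProjection_of_evalMatrix fun x => by
      rw [heval, hg]
      split_ifs with hx
      · exact isStarProjection_inv_smul_mul_single_mul (Q.isStarProjection_fiber x) (hi x hx)
      · rw [zero_smul]
        exact .zero _⟩
  have hE (x : X) : E.fiber x = g x • (Q.fiber x * single i i 1 * Q.fiber x) := heval x
  refine ⟨E, fun a b => evalMatrix_ext fun x => ?_, le_iff_fiber.2 fun x => ?_, fun x => ?_⟩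
  · have key (c : Matrix (Fin n) (Fin n) C(X, ℂ)) : ∃ r : ℂ,
        evalMatrix x (E.1 * c * E.1) = r • (Q.fiber x * single i i 1 * Q.fiber x) := by
      refine ⟨g x * g x * (Q.fiber x * evalMatrix x c * Q.fiber x) i i, ?_⟩
      rw [map_mul, map_mul, ← fiber, hE, Matrix.smul_mul, smul_mul_smul_comm,
        mul_single_mul_mul_mul_single_mul, smul_smul]
    obtain ⟨r, hr⟩ := key a
    obtain ⟨s, hs⟩ := key b
    rw [map_mul _ (E.1 * a * E.1), map_mul _ (E.1 * b * E.1), hr, hs, smul_mul_smul_comm, smul_mul_smul_comm, mul_comm r s]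
  · rw [hE, Matrix.smul_mul, mul_assoc, (Q.isStarProjection_fiber x).isIdempotentElem.eq]
  · rw [hE, hg]
    split_ifs with hx
    · refine iff_of_true (fun h => hi x hx ?_) hx
      -- If this product vanished, compressing it by the matrix unit would give `(Q.fiber x i i) ^ 2
      -- = 0`.
      have h0 : Q.fiber x * single i i 1 * Q.fiber x = 0 :=
        (smul_eq_zero.1 h).resolve_left (inv_ne_zero (hi x hx))
      have h1 : single i i 1 * (Q.fiber x * single i i 1 * Q.fiber x) * single i i (1 : ℂ) = 0 := by
        rw [h0, mul_zero, zero_mul]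
      have h2 : single i i 1 * (Q.fiber x * single i i 1 * Q.fiber x) * single i i (1 : ℂ) =
          single i i (1 : ℂ) * Q.fiber x * single i i 1 * Q.fiber x * single i i 1 := by
        simp only [mul_assoc]
      rw [h2, single_mul_mul_single, single_mul_mul_single] at h1
      simpa using congr($h1 i i)
    · simp [hx]

end ProjectionLattice

end ContinuousMatrix

/-! ### Quasipoints over a Stone space. -/

namespace ProjectionLattice

open Matrix

instance {R : Type*} [Ring R] [StarRing R] [Nontrivial R] : Nontrivial (ProjectionLattice R) :=
  ⟨⟨0, .zero R⟩, ⟨1, .one R⟩, fun h => zero_ne_one (congrArg Subtype.val h)⟩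

variable {n : ℕ} {X : Type*} [TopologicalSpace X]
  {B : Set (ProjectionLattice (Matrix (Fin n) (Fin n) C(X, ℂ)))}

theorem fiber_ne_zero_of_le {P Q : ProjectionLattice (Matrix (Fin n) (Fin n) C(X, ℂ))} (h : P ≤ Q)
    {x : X} (hx : P.fiber x ≠ 0) : Q.fiber x ≠ 0 := fun h0 => hx <| by
  rw [← le_iff_fiber.1 h x, h0, mul_zero]

/-- The supports of the elements of a filter base have a common point. -/
theorem exists_forall_fiber_ne_zero [CompactSpace X] [Nonempty X] (hB : IsFilterBase B) :
    ∃ x, ∀ Q ∈ B, Q.fiber x ≠ 0 := by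
  rcases B.eq_empty_or_nonempty with rfl | hne
  · exact ⟨Classical.arbitrary X, by simp⟩
  have := hne.to_subtype
  obtain ⟨x, hx⟩ := IsCompact.nonempty_iInter_of_directed_nonempty_isCompact_isClosed
    (fun Q : B => {x | Q.1.fiber x ≠ 0})
    (fun P Q => by
      obtain ⟨S, hS, hSP, hSQ⟩ := hB.2 P P.2 Q Q.2
      exact ⟨⟨S, hS⟩, fun x => fiber_ne_zero_of_le hSP, fun x => fiber_ne_zero_of_le hSQ⟩)
    (fun Q => exists_fiber_ne_zero fun h => hB.1 (h ▸ Q.2))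
    (fun Q => (isClopen_setOf_fiber_ne_zero Q.1).isClosed.isCompact)
    (fun Q => (isClopen_setOf_fiber_ne_zero Q.1).isClosed)
  exact ⟨x, fun Q hQ => Set.mem_iInter.1 hx ⟨Q, hQ⟩⟩

/-- A nonempty set of projections has an element of minimal rank at a given point. -/
theorem exists_forall_le_trace_fiber_eq (hne : B.Nonempty) (x : X) :
    ∃ Q ∈ B, ∀ P ∈ B, P ≤ Q → (P.fiber x).trace = (Q.fiber x).trace := by
  classical
  have hex : ∃ k : ℕ, ∃ Q ∈ B, (Q.fiber x).trace = k := by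
    obtain ⟨Q, hQ⟩ := hne
    obtain ⟨k, hk⟩ := exists_nat_trace_eq_of_isStarProjection (Q.isStarProjection_fiber x)
    exact ⟨k, Q, hQ, hk⟩
  obtain ⟨Q, hQ, hk⟩ := Nat.find_spec hex
  refine ⟨Q, hQ, fun P hP hPQ => ?_⟩
  obtain ⟨l, hl⟩ := exists_nat_trace_eq_of_isStarProjection (P.isStarProjection_fiber x)
  -- The difference of the fibers is a projection, so its trace is nonnegative: the rank of `P` is
  -- at most that of `Q`, and minimality gives equality.
  obtain ⟨d, hd⟩ := exists_nat_trace_eq_of_isStarProjection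
    ((P.isStarProjection_fiber x).sub_of_mul_eq_left (Q.isStarProjection_fiber x)
      (le_iff_fiber.1 hPQ x))
  have hmin : Nat.find hex ≤ l := Nat.find_min' hex ⟨P, hP, hl⟩
  rw [trace_sub, hk, hl, sub_eq_iff_eq_add] at hd
  rw [hl, hk]
  norm_cast at hd ⊢
  omega

/-- Every quasipoint of the projection lattice of the matrices of continuous functions on a Stone
space contains an abelian projection. -/
theorem exists_isAbelian_mem [CompactSpace X] [T2Space X] [TotallyDisconnectedSpace X] [Nonempty X]
    (hn : 1 ≤ n) (hB : IsQuasipoint B) : ∃ E ∈ B, E.IsAbelian := by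
  classical
  have : Nonempty (Fin n) := ⟨⟨0, hn⟩⟩
  obtain ⟨x, hx⟩ := exists_forall_fiber_ne_zero hB.1
  obtain ⟨Q, hQ, hmin⟩ := exists_forall_le_trace_fiber_eq hB.nonempty x
  obtain ⟨k, hk⟩ := exists_nat_trace_eq_of_isStarProjection (Q.isStarProjection_fiber x)
  obtain ⟨i, hi⟩ : ∃ i, Q.fiber x i i ≠ 0 := by
    by_contra! h
    exact hx Q hQ (eq_zero_of_isStarProjection_of_trace_eq_zero (Q.isStarProjection_fiber x)
      (Finset.sum_eq_zero fun i _ => h i))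
  have hopen : IsOpen ({y | (Q.fiber y).trace = k} ∩ {y | Q.1 i i y ≠ 0}) :=
    (Q.isClopen_setOf_trace_fiber_eq k).isOpen.inter (isOpen_ne.preimage (Q.1 i i).continuous)
  obtain ⟨U, hU, hxU, hUsub⟩ := compact_exists_isClopen_in_isOpen hopen ⟨hk, hi⟩
  obtain ⟨E, hEab, hEQ, hE⟩ := exists_isAbelian hU Q fun y hy => (hUsub hy).2
  let S : Set (ProjectionLattice (Matrix (Fin n) (Fin n) C(X, ℂ))) :=
    {F | ∃ (W : Set X) (hW : IsClopen W), x ∈ W ∧ F = restrict hW E}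
  have hS : IsFilterBase S := by
    refine ⟨?_, ?_⟩
    · rintro ⟨W, hW, hxW, h⟩
      have h' := fiber_restrict hW E x
      rw [← h, fiber_bot, if_pos hxW] at h'
      exact (hE x).2 hxU h'.symm
    · rintro _ ⟨V, hV, hxV, rfl⟩ _ ⟨W, hW, hxW, rfl⟩
      refine ⟨_, ⟨V ∩ W, hV.inter hW, ⟨hxV, hxW⟩, rfl⟩, ?_, ?_⟩ <;>
      · rw [le_iff_fiber]
        intro y
        simp only [fiber_restrict, Set.mem_inter_iff]
        by_cases hyV : y ∈ V <;> by_cases hyW : y ∈ W <;>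
          simp [hyV, hyW, (E.isStarProjection_fiber y).isIdempotentElem.eq]
  have hcoinitial : ∀ P ∈ B, ∃ F ∈ S, F ≤ P := by
    intro P hP
    obtain ⟨C, hC, hCP, hCQ⟩ := hB.1.2 P hP Q hQ
    have hW := C.isClopen_setOf_trace_fiber_eq k
    refine ⟨_, ⟨_, hU.inter hW, ⟨hxU, (hmin C hC hCQ).trans hk⟩, rfl⟩, le_trans ?_ hCP⟩
    rw [le_iff_fiber]
    intro y
    rw [fiber_restrict]
    split_ifs with hy
    -- Here `C ≤ Q` have equal rank `k`, so their fibers coincide and `E ≤ Q` gives `E ≤ C` at `y`.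
    · rw [eq_of_isStarProjection_of_trace_eq (C.isStarProjection_fiber y)
        (Q.isStarProjection_fiber y) (le_iff_fiber.1 hCQ y) (hy.2.trans (hUsub hy.1).1.symm)]
      exact le_iff_fiber.1 hEQ y
    · exact zero_mul _
  -- `E` itself belongs to `S`, as its restriction to the whole space.
  refine ⟨E, hB.subset_of_coinitial hS hcoinitial ⟨Set.univ, isClopen_univ, trivial, ?_⟩, hEab⟩
  exact ext_fiber fun y => by rw [fiber_restrict, if_pos (Set.mem_univ y)]

end ProjectionLattice

theorem mainTheorem2 {H : Type*} [NormedAddCommGroup H] [InnerProductSpace ℂ H] [CompleteSpace H]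
    [Nontrivial H] (A : VonNeumannAlgebra H) (hA : A.IsAbelian) (n : ℕ) (hn : 1 ≤ n)
    (B : Set (ProjectionLattice (VonNeumannAlgebra.MatrixAlgebra n A))) (hB : IsQuasipoint B) :
    IsAbelianQuasipoint B := by
  obtain ⟨X, _, _, _, _, _, ⟨f⟩⟩ := hA.exists_starAlgEquiv
  exact IsAbelianQuasipoint.of_starRingEquiv (StarRingEquiv.mapMatrix (f : _ ≃⋆+* C(X, ℂ)))
    (fun _ => ProjectionLattice.exists_isAbelian_mem hn) hB
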